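/- There is a universal constant $C>0$ such that the following holds. Let $H$ be a Hermitian operator on $\mathbb{C}^d$, $d\ge 2$ (for instance $d=2^n$ for $n\geq 1$ qubits), with spectral decomposition $H=\sum_i E_i|\psi_i\rangle\langle\psi_i|$, and let $\beta>0$ and $\sigma_t>0$. Let $\{A^a\}_{a\in A}$ be a finite family of operators on $\mathbb{C}^d$ (the jump operators) that is closed under adjoints, i.e. there is a permutation $a\mapsto a'$ of $A$ with $A^{a'}=(A^a)^\dagger$ for each $a$, and that is normalized so that $\|\sum_{a\in A}A^{a\dagger}A^a\|\le 1$ in operator norm. Let $\gamma:\mathbb{R}\to[0,1]$ be a measurable function with $\gamma(\omega)=e^{-\beta\omega}\gamma(-\omega)$ for all $\omega\in\mathbb{R}$. Let $f(t)=\big(\sigma_t\sqrt{2\pi}\big)^{-1/2}e^{-t^2/(4\sigma_t^2)}$ be the $L^2$-normalized Gaussian filter of width $\sigma_t$, let $$\hat A^a(\omega)=\frac{1}{\sqrt{2\pi}}\int_{-\infty}^{\infty}e^{-i\omega t}f(t)\,e^{iHt}A^ae^{-iHt}\,dt ,$$ and define the discriminant proxy on $\mathbb{C}^d\otimes\mathbb{C}^d$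 by $$\vec{\mathcal D}_\beta=\sum_{a\in A}\int_{-\infty}^{\infty}\Big[\sqrt{\gamma(\omega)\gamma(-\omega)}\,\hat A^a(\omega)\otimes\hat A^a(\omega)^*-\frac{\gamma(\omega)}{2}\Big(\hat A^a(\omega)^\dagger\hat A^a(\omega)\otimes I+I\otimes\hat A^a(\omega)^{\dagger *}\hat A^a(\omega)^*\Big)\Big]d\omega ,$$ where ${}^*$ denotes entrywise complex conjugation. Then $\vec{\mathcal D}_\beta$ is Hermitian. Let $\lambda_1\ge\lambda_2\ge\cdots$ be its eigenvalues counted with multiplicity and $\lambda_{gap}(\vec{\mathcal D}_\beta)=\lambda_1-\lambda_2$. If $\lambda_{gap}(\vec{\mathcal D}_\beta)>0$, then every unit eigenvector $|\lambda_1(\vec{\mathcal D}_\beta)\rangle$ of $\vec{\mathcal D}_\beta$ with eigenvalue $\lambda_1$ satisfies, after multiplication by a suitable complex phase, $$\Big\|\,|\lambda_1(\vec{\mathcal D}_\beta)\rangle-|\sqrt{\rho_\beta}\rangle\Big\|\le C\,\frac{\beta}{\sigma_t}\sqrt{\log\!\big(2+\sigma_t/\beta\big)}\;\frac{1}{\lambda_{gap}(\vec{\mathcal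 D}_\beta)}=\tilde{\mathcal O}\Big(\frac{\beta}{\sigma_t}\,\frac{1}{\lambda_{gap}(\vec{\mathcal D}_\beta)}\Big)$$ in Euclidean norm, where $|\sqrt{\rho_\beta}\rangle=\big(\mathrm{Tr}\,e^{-\beta H}\big)^{-1/2}\sum_i e^{-\beta E_i/2}|\psi_i\rangle\otimes|\psi_i^*\rangle$ is the purified Gibbs (thermofield double) state. -/

import Mathlib

open scoped Matrix Kronecker

noncomputable section

namespace GibbsSampling

/-- The Gaussian filter of width `σ`, normalized in `L²(ℝ)`:
`f(t) = (σ √(2π))^{-1/2} exp(-t² / (4σ²))`. -/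
def gaussianFilter (σ t : ℝ) : ℝ :=
  (√(σ * √(2 * Real.pi)))⁻¹ * Real.exp (-t ^ 2 / (4 * σ ^ 2))

/-- Heisenberg evolution `A(t) = e^{iHt} A e^{-iHt}`. -/
def heisenberg {d : ℕ} (H A : Matrix (Fin d) (Fin d) ℂ) (t : ℝ) : Matrix (Fin d) (Fin d) ℂ :=
  NormedSpace.exp ((Complex.I * (t : ℂ)) • H) * A * NormedSpace.exp (-(Complex.I * (t : ℂ)) • H)

/-- The operator Fourier transform of `A` with respect to `H`, weighted by the real filter `f`:
`Â(ω) = (2π)^{-1/2} ∫ e^{-iωt} f(t) A(t) dt`, the integral being taken entry by entry. -/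
def operatorFT {d : ℕ} (H : Matrix (Fin d) (Fin d) ℂ) (f : ℝ → ℝ)
    (A : Matrix (Fin d) (Fin d) ℂ) (ω : ℝ) : Matrix (Fin d) (Fin d) ℂ :=
  Matrix.of fun i j =>
    ((√(2 * Real.pi) : ℝ) : ℂ)⁻¹ *
      ∫ t : ℝ, Complex.exp (-(Complex.I * (ω : ℂ) * (t : ℂ))) * (f t : ℂ) * heisenberg H A t i j

/-- Entrywise complex conjugate of a matrix. -/
def conjEntries {d : ℕ} (M : Matrix (Fin d) (Fin d) ℂ) : Matrix (Fin d) (Fin d) ℂ :=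
  M.map (starRingEnd ℂ)

/-- The contribution to the discriminant proxy of a single Fourier transformed jump `B = Â(ω)`
with transition weights `g = γ(ω)` and `g' = γ(-ω)`:
`√(g g') B ⊗ B* - (g/2) (B†B ⊗ I + I ⊗ B†* B*)`. -/
def discriminantTerm {d : ℕ} (g g' : ℝ) (B : Matrix (Fin d) (Fin d) ℂ) :
    Matrix (Fin d × Fin d) (Fin d × Fin d) ℂ :=
  ((√(g * g') : ℝ) : ℂ) • (B ⊗ₖ conjEntries B) -
    ((g / 2 : ℝ) : ℂ) •
      ((Bᴴ * B) ⊗ₖ (1 : Matrix (Fin d) (Fin d) ℂ) +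
        (1 : Matrix (Fin d) (Fin d) ℂ) ⊗ₖ (conjEntries Bᴴ * conjEntries B))

/-- The (vectorized) discriminant proxy of the jumps `A a`, the Hamiltonian `H`, the filter `f` and
the transition weight `γ`; sum over the jumps and integral over all frequencies, entry by entry. -/
def discriminantProxy {d m : ℕ} (H : Matrix (Fin d) (Fin d) ℂ)
    (A : Fin m → Matrix (Fin d) (Fin d) ℂ) (f γ : ℝ → ℝ) :
    Matrix (Fin d × Fin d) (Fin d × Fin d) ℂ :=
  Matrix.of fun p q =>
    ∑ a, ∫ ω : ℝ, discriminantTerm (γ ω) (γ (-ω)) (operatorFT H f (A a) ω) p q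

/-- The purified Gibbs (thermofield double) state
`Z^{-1/2} ∑ₖ e^{-βEₖ/2} ψₖ ⊗ ψₖ*`, where `H = ∑ₖ Eₖ |ψₖ⟩⟨ψₖ|` and `Z = ∑ₖ e^{-βEₖ} = Tr e^{-βH}`. -/
def purifiedGibbs {d : ℕ} {H : Matrix (Fin d) (Fin d) ℂ} (hH : H.IsHermitian) (β : ℝ) :
    EuclideanSpace ℂ (Fin d × Fin d) :=
  WithLp.toLp 2 fun p =>
    ((√(∑ k, Real.exp (-β * hH.eigenvalues k)) : ℝ) : ℂ)⁻¹ *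
      ∑ k, ((Real.exp (-β * hH.eigenvalues k / 2) : ℝ) : ℂ) *
        (hH.eigenvectorBasis k p.1 * (starRingEnd ℂ) (hH.eigenvectorBasis k p.2))

/-- The eigenvalue number `k` (counting from `0`) of a Hermitian matrix, the eigenvalues being listed
in decreasing order with multiplicity; only used for `k` smaller than the dimension. -/
def sortedEigenvalue {n : Type} [Fintype n] [DecidableEq n] {M : Matrix n n ℂ}
    (hM : M.IsHermitian) (k : ℕ) : ℝ :=
  if h : k < Fintype.card n then hM.eigenvalues₀ ⟨k, h⟩ else 0

/-- The spectral gap `λ₁ - λ₂` between the two largest eigenvalues (with multiplicity). -/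
def spectralGap {n : Type} [Fintype n] [DecidableEq n] {M : Matrix n n ℂ}
    (hM : M.IsHermitian) : ℝ :=
  sortedEigenvalue hM 0 - sortedEigenvalue hM 1

end GibbsSampling

end

namespace GibbsSampling

open MeasureTheory ProbabilityTheory

/-! ### The Gaussian filter: moments and Fourier transform -/

section Gaussian

/-! Identify vectors with matrices `X`. The quadratic form of the proxy is a negative Dirichlet
form, `-(1/2) ∑ₐ ∫ ‖√γ(ω) Â X - √γ(-ω) X Â‖² dω` in Frobenius norm (`re_discriminantProxy_form`):
completing the square leaves a remainder that cancels under `ω ↦ -ω`, `a ↦ a'`. Hence the top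
eigenvalue is at most `0`.

In the eigenbasis of `H`, `Â(ω)` has entries `f̂(ω - (Eₖ - Eₗ)) Aₖₗ`, where `f̂` is a Gaussian of
width `1/(2σ)`. For `X = √ρ` detailed balance gives `√γ(ω) xₗ = √γ(-ω) xₖ e^{-βu/2}` with `u = ω -
(Eₖ - Eₗ)`: only the energy uncertainty `u` spoils exact stationarity. Bounding the square by `(xₗ²
+ xₖ²)(βu/2)²` and using the variance of `f̂²`, the form at the Gibbs state is at least `-ε²`, `ε =
β/(4σ)` (`neg_sq_le_re_inner_purifiedGibbs`).

A vector `r` whose form is within `ε²` of the top satisfies `gap · (1 - |⟨v, r⟩|²) ≤ ε²`. This alone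
gives a distance of order `ε/√gap`. The form is also at least `-1` on two orthonormal vectors, so
`gap ≤ 2`, and the bound becomes `2ε/gap` (`exists_phase_norm_sub_le_of_form_bounds`). No logarithm
is incurred; the factor in the statement is only bounded below. -/

lemma gaussianFilter_sq {s : ℝ} (hs : 0 < s) (t : ℝ) :
    gaussianFilter s t ^ 2 = gaussianPDFReal 0 (s ^ 2).toNNReal t := by
  have h2 : (0 : ℝ) ≤ 2 * Real.pi := by positivity
  have h : √(2 * Real.pi * s ^ 2) = s * √(2 * Real.pi) := by
    rw [Real.sqrt_mul h2, Real.sqrt_sq hs.le, mul_comm]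
  rw [gaussianFilter, gaussianPDFReal, mul_pow, inv_pow, Real.sq_sqrt (by positivity),
    ← Real.exp_nat_mul]
  simp only [Real.coe_toNNReal _ (sq_nonneg s), h, sub_zero]
  congr 2
  field_simp
  ring

lemma integrable_gaussianFilter_sq {s : ℝ} (hs : 0 < s) :
    Integrable fun t => gaussianFilter s t ^ 2 := by
  simp_rw [gaussianFilter_sq hs]
  exact integrable_gaussianPDFReal _ _

lemma integral_gaussianFilter_sq {s : ℝ} (hs : 0 < s) :
    ∫ t, gaussianFilter s t ^ 2 = 1 := by
  simp_rw [gaussianFilter_sq hs]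
  exact integral_gaussianPDFReal_eq_one _ (Real.toNNReal_pos.2 (pow_pos hs 2)).ne'

lemma continuous_gaussianFilter (s : ℝ) : Continuous (gaussianFilter s) := by
  unfold gaussianFilter
  fun_prop

lemma gaussianFilter_neg (s t : ℝ) : gaussianFilter s (-t) = gaussianFilter s t := by
  simp [gaussianFilter]

lemma gaussianFilter_nonneg (s t : ℝ) : 0 ≤ gaussianFilter s t := by
  unfold gaussianFilter
  positivity

lemma gaussianFilter_le (s t : ℝ) : gaussianFilter s t ≤ gaussianFilter s 0 := by
  unfold gaussianFilter
  gcongr _ * Real.exp (?_ / _)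
  nlinarith [sq_nonneg t]

lemma gaussianFilter_eq_exp (s t : ℝ) :
    gaussianFilter s t = (√(s * √(2 * Real.pi)))⁻¹ * Real.exp (-(4 * s ^ 2)⁻¹ * t ^ 2) := by
  rw [gaussianFilter]
  congr 2
  ring

lemma integrable_gaussianFilter {s : ℝ} (hs : 0 < s) : Integrable (gaussianFilter s) := by
  simp_rw [funext (gaussianFilter_eq_exp s)]
  exact (integrable_exp_neg_mul_sq (by positivity)).const_mul _

lemma integrable_gaussianFilter_sq_mul_sq {s : ℝ} (hs : 0 < s) :
    Integrable fun t => gaussianFilter s t ^ 2 * t ^ 2 := by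
  have h := (integrable_rpow_mul_exp_neg_mul_sq (b := 2 * (4 * s ^ 2)⁻¹) (by positivity)
    (s := 2) (by norm_num)).const_mul ((√(s * √(2 * Real.pi)))⁻¹ ^ 2)
  refine h.congr (Filter.Eventually.of_forall fun t => ?_)
  simp only [gaussianFilter_eq_exp, mul_pow, ← Real.exp_nat_mul, Real.rpow_ofNat]
  push_cast
  ring_nf

/-- The squared filter is the density of a centred normal law, so this is its variance. With `s =
1/(2σ)` it supplies the mean square energy uncertainty. -/
lemma integral_gaussianFilter_sq_mul_sq {s : ℝ} (hs : 0 < s) :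
    ∫ t, gaussianFilter s t ^ 2 * t ^ 2 = s ^ 2 := by
  have hv : ((s ^ 2).toNNReal : NNReal) ≠ 0 := (Real.toNNReal_pos.2 (pow_pos hs 2)).ne'
  have h := variance_fun_id_gaussianReal (μ := 0) (v := (s ^ 2).toNNReal)
  rw [variance_eq_integral measurable_id'.aemeasurable] at h
  simp only [integral_id_gaussianReal, sub_zero] at h
  rw [integral_gaussianReal_eq_integral_smul hv] at h
  simp_rw [gaussianFilter_sq hs]
  simpa [Real.coe_toNNReal _ (sq_nonneg s)] using h

lemma fourier_gaussianFilter {σ : ℝ} (hσ : 0 < σ) (ω : ℝ) :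
    ((√(2 * Real.pi) : ℝ) : ℂ)⁻¹ *
      ∫ t : ℝ, Complex.exp (-(Complex.I * (ω : ℂ) * (t : ℂ))) * (gaussianFilter σ t : ℂ) =
      (gaussianFilter (1 / (2 * σ)) ω : ℂ) := by
  have hb : 0 < (4 * σ ^ 2)⁻¹ := by positivity
  have h := fourierIntegral_gaussian (b := (((4 * σ ^ 2)⁻¹ : ℝ) : ℂ)) (by rwa [Complex.ofReal_re]) (-ω)
  have e : ∀ t : ℝ, Complex.exp (-(Complex.I * (ω : ℂ) * (t : ℂ))) * (gaussianFilter σ t : ℂ) =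
      (((√(σ * √(2 * Real.pi)))⁻¹ : ℝ) : ℂ) * (Complex.exp (Complex.I * (-ω : ℂ) * t) *
        Complex.exp (-(((4 * σ ^ 2)⁻¹ : ℝ) : ℂ) * t ^ 2)) := by
    intro t
    rw [gaussianFilter_eq_exp]
    push_cast
    ring_nf
  simp_rw [e]
  rw [integral_const_mul, h]
  have e2 : ((Real.pi : ℂ) / (((4 * σ ^ 2)⁻¹ : ℝ) : ℂ)) ^ (1 / 2 : ℂ) =
      ((√(Real.pi / (4 * σ ^ 2)⁻¹) : ℝ) : ℂ) := by
    rw [Real.sqrt_eq_rpow, Complex.ofReal_cpow (by positivity)]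
    push_cast
    rfl
  have e3 : Complex.exp (-(-ω : ℂ) ^ 2 / (4 * (((4 * σ ^ 2)⁻¹ : ℝ) : ℂ))) =
      ((Real.exp (-(4 * (1 / (2 * σ)) ^ 2)⁻¹ * ω ^ 2) : ℝ) : ℂ) := by
    push_cast
    congr 1
    have : (σ : ℂ) ≠ 0 := by exact_mod_cast hσ.ne'
    field_simp
    ring
  rw [e2, e3, gaussianFilter_eq_exp, ← Complex.ofReal_inv, ← Complex.ofReal_mul,
    ← Complex.ofReal_mul, ← Complex.ofReal_mul]
  congr 1
  rw [← mul_assoc, ← mul_assoc]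
  congr 1
  have hp := Real.pi_pos
  -- Only the prefactors remain; both are positive, so squaring them removes the nested roots.
  refine (sq_eq_sq₀ (by positivity) (by positivity)).1 ?_
  simp only [mul_pow, inv_pow]
  rw [Real.sq_sqrt (by positivity), Real.sq_sqrt (by positivity), Real.sq_sqrt (by positivity),
    Real.sq_sqrt (by positivity)]
  have h2 : √(2 * Real.pi) ^ 2 = 2 * Real.pi := Real.sq_sqrt (by positivity)
  have h3 : 0 < √(2 * Real.pi) := by positivity
  field_simp
  linarith

end Gaussian

/-! ### The operator Fourier transform in the eigenbasis of the Hamiltonian -/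

section Diagonalization

variable {d : ℕ} {U : Matrix (Fin d) (Fin d) ℂ} {E : Fin d → ℝ} {H : Matrix (Fin d) (Fin d) ℂ}

lemma exp_smul_of_diagonalization (hU : Uᴴ * U = 1)
    (hH : H = U * Matrix.diagonal (fun k => (E k : ℂ)) * Uᴴ) (c : ℂ) :
    NormedSpace.exp (c • H) = U * Matrix.diagonal (fun k => Complex.exp (c * E k)) * Uᴴ := by
  have hi : U⁻¹ = Uᴴ := Matrix.inv_eq_left_inv hU
  have hu : IsUnit U := Matrix.isUnit_iff_isUnit_det _ |>.2 (Matrix.isUnit_det_of_left_inverse hU)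
  have e : c • H = U * Matrix.diagonal (fun k => c * (E k : ℂ)) * U⁻¹ := by
    rw [hH, hi, ← Matrix.smul_mul, ← Matrix.mul_smul, ← Matrix.diagonal_smul]
    rfl
  rw [e, Matrix.exp_conj _ _ hu, Matrix.exp_diagonal, hi]
  congr 3
  funext k
  rw [Pi.coe_exp, Complex.exp_eq_exp_ℂ]

lemma heisenberg_of_diagonalization (hU : Uᴴ * U = 1)
    (hH : H = U * Matrix.diagonal (fun k => (E k : ℂ)) * Uᴴ)
    (A : Matrix (Fin d) (Fin d) ℂ) (t : ℝ) :
    heisenberg H A t = U * (Matrix.of fun k l =>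
      Complex.exp (Complex.I * t * (E k - E l)) * (Uᴴ * A * U) k l) * Uᴴ := by
  have e : (Matrix.of fun k l => Complex.exp (Complex.I * t * (E k - E l)) * (Uᴴ * A * U) k l) =
      Matrix.diagonal (fun k => Complex.exp (Complex.I * t * E k)) * (Uᴴ * A * U) *
        Matrix.diagonal (fun k => Complex.exp (-(Complex.I * t) * E k)) := by
    ext k l
    rw [Matrix.mul_diagonal, Matrix.diagonal_mul, Matrix.of_apply,
      mul_right_comm (Complex.exp _), ← Complex.exp_add]
    congr 2
    ring
  rw [e, heisenberg, exp_smul_of_diagonalization hU hH, exp_smul_of_diagonalization hU hH]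
  simp only [Matrix.mul_assoc]

/-- Evolution multiplies the `(k, l)` entry by the phase `e^{it(Eₖ - Eₗ)}`, which shifts the
frequency of the filter's transform by the Bohr frequency `Eₖ - Eₗ`. -/
lemma operatorFT_of_diagonalization (hU : Uᴴ * U = 1)
    (hH : H = U * Matrix.diagonal (fun k => (E k : ℂ)) * Uᴴ)
    (A : Matrix (Fin d) (Fin d) ℂ) {σ : ℝ} (hσ : 0 < σ) (ω : ℝ) :
    operatorFT H (gaussianFilter σ) A ω = U * (Matrix.of fun k l =>
      (gaussianFilter (1 / (2 * σ)) (ω - (E k - E l)) : ℂ) * (Uᴴ * A * U) k l) * Uᴴ := by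
  ext i j
  have hint : ∀ ν : ℝ, Integrable fun t : ℝ =>
      Complex.exp (-(Complex.I * (ν : ℂ) * (t : ℂ))) * (gaussianFilter σ t : ℂ) := by
    intro ν
    refine (integrable_gaussianFilter hσ).ofReal.bdd_mul (c := 1) ?_ ?_
    · exact Continuous.aestronglyMeasurable (by fun_prop)
    · refine Filter.Eventually.of_forall fun t => le_of_eq ?_
      rw [Complex.norm_exp]
      simp
  have e : ∀ t : ℝ, Complex.exp (-(Complex.I * (ω : ℂ) * (t : ℂ))) * (gaussianFilter σ t : ℂ) *
      heisenberg H A t i j = ∑ l, ∑ k, (U i k * (Uᴴ * A * U) k l * Uᴴ l j) *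
        (Complex.exp (-(Complex.I * ((ω - (E k - E l) : ℝ) : ℂ) * (t : ℂ))) *
          (gaussianFilter σ t : ℂ)) := by
    intro t
    rw [heisenberg_of_diagonalization hU hH, Matrix.mul_apply, Finset.mul_sum]
    refine Finset.sum_congr rfl fun l _ => ?_
    rw [Matrix.mul_apply, Finset.sum_mul, Finset.mul_sum]
    refine Finset.sum_congr rfl fun k _ => ?_
    rw [Matrix.of_apply]
    have : Complex.exp (-(Complex.I * ((ω - (E k - E l) : ℝ) : ℂ) * (t : ℂ))) =
        Complex.exp (-(Complex.I * (ω : ℂ) * (t : ℂ))) *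
          Complex.exp (Complex.I * t * (E k - E l)) := by
      rw [← Complex.exp_add]
      congr 1
      push_cast
      ring
    rw [this]
    ring
  rw [operatorFT, Matrix.of_apply]
  simp_rw [e]
  rw [integral_finsetSum _ fun l _ => integrable_finsetSum _ fun k _ => (hint _).const_mul _,
    Finset.mul_sum, Matrix.mul_apply]
  refine Finset.sum_congr rfl fun l _ => ?_
  rw [integral_finsetSum _ fun k _ => (hint _).const_mul _, Finset.mul_sum, Matrix.mul_apply,
    Finset.sum_mul]
  refine Finset.sum_congr rfl fun k _ => ?_
  rw [integral_const_mul, Matrix.of_apply, ← fourier_gaussianFilter hσ]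
  ring

lemma exists_diagonalization (hH : H.IsHermitian) :
    (hH.eigenvectorUnitary : Matrix (Fin d) (Fin d) ℂ)ᴴ * hH.eigenvectorUnitary = 1 ∧
      H = (hH.eigenvectorUnitary : Matrix (Fin d) (Fin d) ℂ) *
        Matrix.diagonal (fun k => (hH.eigenvalues k : ℂ)) *
          (hH.eigenvectorUnitary : Matrix (Fin d) (Fin d) ℂ)ᴴ := by
  refine ⟨Unitary.coe_star_mul_self _, ?_⟩
  conv_lhs => rw [hH.spectral_theorem]
  rw [Unitary.conjStarAlgAut_apply]
  rfl

/-- The transformed filter is real and even, and taking adjoints reverses Bohr frequencies. Combined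
with closure of the jumps under adjoints, this drives every `ω ↦ -ω` symmetry below. -/
lemma conjTranspose_operatorFT (hH : H.IsHermitian) (A : Matrix (Fin d) (Fin d) ℂ)
    {σ : ℝ} (hσ : 0 < σ) (ω : ℝ) :
    (operatorFT H (gaussianFilter σ) A ω)ᴴ = operatorFT H (gaussianFilter σ) Aᴴ (-ω) := by
  obtain ⟨h1, h2⟩ := exists_diagonalization hH
  rw [operatorFT_of_diagonalization h1 h2 A hσ, operatorFT_of_diagonalization h1 h2 Aᴴ hσ]
  rw [Matrix.conjTranspose_mul, Matrix.conjTranspose_mul, Matrix.conjTranspose_conjTranspose,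
    ← Matrix.mul_assoc]
  congr 2
  ext k l
  rw [Matrix.conjTranspose_apply, Matrix.of_apply, Matrix.of_apply, star_mul', ← gaussianFilter_neg]
  congr 1
  · rw [RCLike.star_def, Complex.conj_ofReal]
    congr 2
    ring
  · rw [← Matrix.conjTranspose_apply]
    simp only [Matrix.conjTranspose_mul, Matrix.conjTranspose_conjTranspose, Matrix.mul_assoc]

end Diagonalization

/-! ### Integrability of the entries against a bounded weight -/

section BddIntegrable

/-- Continuous, bounded and integrable functions on the line. -/
structure BddIntegrable (f : ℝ → ℂ) : Prop where
  continuous : Continuous f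
  integrable : Integrable f
  bounded : ∃ K, ∀ x, ‖f x‖ ≤ K

namespace BddIntegrable

lemma const_mul {f : ℝ → ℂ} (hf : BddIntegrable f) (c : ℂ) : BddIntegrable fun x => c * f x := by
  obtain ⟨K, hK⟩ := hf.bounded
  refine ⟨hf.continuous.const_mul c, hf.integrable.const_mul c, ‖c‖ * K, fun x => ?_⟩
  rw [norm_mul]
  exact mul_le_mul_of_nonneg_left (hK x) (norm_nonneg c)

lemma mul_const {f : ℝ → ℂ} (hf : BddIntegrable f) (c : ℂ) : BddIntegrable fun x => f x * c := by
  simpa only [mul_comm] using hf.const_mul c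

lemma sum {ι : Type*} {f : ι → ℝ → ℂ} (s : Finset ι) (hf : ∀ i ∈ s, BddIntegrable (f i)) :
    BddIntegrable fun x => ∑ i ∈ s, f i x := by
  choose! K hK using fun i hi => (hf i hi).bounded
  exact ⟨continuous_finsetSum s fun i hi => (hf i hi).continuous,
    integrable_finsetSum s fun i hi => (hf i hi).integrable, ∑ i ∈ s, K i,
    fun x => (norm_sum_le _ _).trans (Finset.sum_le_sum fun i hi => hK i hi x)⟩

lemma star {f : ℝ → ℂ} (hf : BddIntegrable f) : BddIntegrable fun x => star (f x) := by
  obtain ⟨K, hK⟩ := hf.bounded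
  refine ⟨hf.continuous.star, ?_, K, fun x => by rw [norm_star]; exact hK x⟩
  exact (integrable_norm_iff hf.continuous.star.aestronglyMeasurable).1
    (by simpa only [norm_star] using hf.integrable.norm)

/-- Every integrand in the proxy is quadratic in the entries of `Â(ω)`: one factor is bounded, the
other integrable, and the weight need only be measurable with values in `[0, 1]`. -/
lemma integrable_weight_mul {f g : ℝ → ℂ} (hf : BddIntegrable f) (hg : BddIntegrable g)
    {c : ℝ → ℝ} (hc : AEMeasurable c) (hc' : ∀ x, 0 ≤ c x ∧ c x ≤ 1) :
    Integrable fun x => (c x : ℂ) * (f x * g x) := by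
  obtain ⟨K, hK⟩ := hf.bounded
  refine (hg.integrable.bdd_mul hf.continuous.aestronglyMeasurable
    (Filter.Eventually.of_forall hK)).bdd_mul (c := 1)
    (Complex.measurable_ofReal.comp_aemeasurable hc).aestronglyMeasurable
    (Filter.Eventually.of_forall fun x => ?_)
  rw [Complex.norm_real, Real.norm_of_nonneg (hc' x).1]
  exact (hc' x).2

lemma matrix_mul_const {n : Type*} [Fintype n] {M : ℝ → Matrix n n ℂ}
    (hM : ∀ i j, BddIntegrable fun x => M x i j) (N : Matrix n n ℂ) (i j : n) :
    BddIntegrable fun x => (M x * N) i j := by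
  simp_rw [Matrix.mul_apply]
  exact sum _ fun k _ => (hM i k).mul_const _

lemma matrix_const_mul {n : Type*} [Fintype n] {M : ℝ → Matrix n n ℂ}
    (hM : ∀ i j, BddIntegrable fun x => M x i j) (N : Matrix n n ℂ) (i j : n) :
    BddIntegrable fun x => (N * M x) i j := by
  simp_rw [Matrix.mul_apply]
  exact sum _ fun k _ => (hM k j).const_mul _

end BddIntegrable

lemma bddIntegrable_gaussianFilter {s : ℝ} (hs : 0 < s) (ν : ℝ) :
    BddIntegrable fun ω => (gaussianFilter s (ω - ν) : ℂ) := by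
  refine ⟨?_, ((integrable_gaussianFilter hs).comp_sub_right ν).ofReal,
    gaussianFilter s 0, fun x => ?_⟩
  · have := continuous_gaussianFilter s
    fun_prop
  · rw [Complex.norm_real, Real.norm_of_nonneg (gaussianFilter_nonneg _ _)]
    exact gaussianFilter_le _ _

lemma bddIntegrable_operatorFT {d : ℕ} {H : Matrix (Fin d) (Fin d) ℂ} (hH : H.IsHermitian)
    (A : Matrix (Fin d) (Fin d) ℂ) {σ : ℝ} (hσ : 0 < σ) (i j : Fin d) :
    BddIntegrable fun ω => operatorFT H (gaussianFilter σ) A ω i j := by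
  obtain ⟨h1, h2⟩ := exists_diagonalization hH
  simp_rw [operatorFT_of_diagonalization h1 h2 A hσ]
  refine BddIntegrable.matrix_mul_const (BddIntegrable.matrix_const_mul (fun k l => ?_) _) _ i j
  exact (bddIntegrable_gaussianFilter (by positivity) _).mul_const _

end BddIntegrable

/-! ### The Frobenius norm -/

section Frobenius

variable {n : Type*} [Fintype n]

/-- The squared Frobenius norm of a matrix. -/
noncomputable def frobeniusSq (M : Matrix n n ℂ) : ℝ := (Mᴴ * M).trace.re

lemma frobeniusSq_eq_sum (M : Matrix n n ℂ) : frobeniusSq M = ∑ j, ∑ i, ‖M i j‖ ^ 2 := by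
  simp only [frobeniusSq, Matrix.trace, Matrix.diag, Matrix.mul_apply, Matrix.conjTranspose_apply,
    Complex.re_sum]
  refine Finset.sum_congr rfl fun j _ => Finset.sum_congr rfl fun i _ => ?_
  rw [RCLike.star_def, ← Complex.normSq_eq_conj_mul_self, Complex.ofReal_re,
    Complex.normSq_eq_norm_sq]

lemma frobeniusSq_nonneg (M : Matrix n n ℂ) : 0 ≤ frobeniusSq M := by
  rw [frobeniusSq_eq_sum]
  positivity

lemma frobeniusSq_conj [DecidableEq n] {U : Matrix n n ℂ} (hU : Uᴴ * U = 1) (M : Matrix n n ℂ) :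
    frobeniusSq (U * M * Uᴴ) = frobeniusSq M := by
  rw [frobeniusSq, Matrix.conjTranspose_mul, Matrix.conjTranspose_mul,
    Matrix.conjTranspose_conjTranspose, Matrix.trace_mul_comm]
  have : U * M * Uᴴ * (U * (Mᴴ * Uᴴ)) = U * (M * (Uᴴ * U) * Mᴴ * Uᴴ) := by
    simp only [Matrix.mul_assoc]
  rw [this, hU, Matrix.trace_mul_comm, Matrix.mul_assoc, hU, Matrix.mul_one, Matrix.mul_one,
    Matrix.trace_mul_comm]
  rfl

lemma frobeniusSq_smul_sub_smul (a b : ℝ) (P Q : Matrix n n ℂ) :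
    frobeniusSq ((a : ℂ) • P - (b : ℂ) • Q) =
      a ^ 2 * frobeniusSq P + b ^ 2 * frobeniusSq Q - 2 * (a * b) * (Qᴴ * P).trace.re := by
  have h : (Pᴴ * Q).trace.re = (Qᴴ * P).trace.re := by
    have : Pᴴ * Q = (Qᴴ * P)ᴴ := by simp
    rw [this, Matrix.trace_conjTranspose, RCLike.star_def, Complex.conj_re]
  simp only [frobeniusSq, Matrix.conjTranspose_sub, Matrix.conjTranspose_smul, Matrix.sub_mul,
    Matrix.mul_sub, Matrix.smul_mul, Matrix.mul_smul, Matrix.trace_sub, Matrix.trace_smul,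
    RCLike.star_def, Complex.conj_ofReal, smul_eq_mul, Complex.sub_re, Complex.re_ofReal_mul, h]
  ring

end Frobenius

/-! ### Algebra of a single term of the proxy -/

section DiscriminantTerm

variable {d : ℕ}

/-- `Matrix.vec` stacks columns; the transpose makes entry `(i, j)` of the vector equal `X i j`, so
that `P ⊗ Q*` acts as `X ↦ P X Q†`. -/
lemma kronecker_conjEntries_mulVec (P Q X : Matrix (Fin d) (Fin d) ℂ) :
    (P ⊗ₖ conjEntries Q) *ᵥ Matrix.vec Xᵀ = Matrix.vec (P * X * Qᴴ)ᵀ := by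
  rw [Matrix.kronecker_mulVec_vec, Matrix.transpose_mul, Matrix.transpose_mul, ← Matrix.mul_assoc]
  rfl

lemma star_vec_transpose_dotProduct (X Y : Matrix (Fin d) (Fin d) ℂ) :
    star (Matrix.vec Xᵀ) ⬝ᵥ Matrix.vec Yᵀ = (Xᴴ * Y).trace := by
  rw [Matrix.star_vec_dotProduct_vec, Matrix.trace_mul_comm, ← Matrix.trace_transpose,
    Matrix.transpose_mul]
  rfl

lemma conjEntries_mul (P Q : Matrix (Fin d) (Fin d) ℂ) :
    conjEntries P * conjEntries Q = conjEntries (P * Q) :=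
  (Matrix.map_mul (f := starRingEnd ℂ)).symm

lemma conjEntries_one : conjEntries (1 : Matrix (Fin d) (Fin d) ℂ) = 1 := by
  simp [conjEntries]

/-- Completing the square: the decay part contributes `g‖BX‖²` and `g‖XB†‖²`, whereas the square
needs `g'‖XB‖²` in place of the latter. The discrepancy vanishes only after summation over jumps and
frequencies. -/
lemma re_discriminantTerm_form {g g' : ℝ} (hg : 0 ≤ g) (hg' : 0 ≤ g')
    (B X : Matrix (Fin d) (Fin d) ℂ) :
    (star (Matrix.vec Xᵀ) ⬝ᵥ (discriminantTerm g g' B *ᵥ Matrix.vec Xᵀ)).re =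
      -(1 / 2) * frobeniusSq (((√g : ℝ) : ℂ) • (B * X) - ((√g' : ℝ) : ℂ) • (X * B)) +
        (1 / 2) * (g' * frobeniusSq (X * B) - g * frobeniusSq (X * Bᴴ)) := by
  have e1 : (Xᴴ * (B * X * Bᴴ)).trace = ((X * B)ᴴ * (B * X)).trace := by
    rw [Matrix.conjTranspose_mul, ← Matrix.mul_assoc, Matrix.trace_mul_comm, Matrix.mul_assoc]
  have e2 : (Xᴴ * (Bᴴ * B * X)).trace.re = frobeniusSq (B * X) := by
    rw [frobeniusSq, Matrix.conjTranspose_mul]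
    simp only [Matrix.mul_assoc]
  have e3 : (Xᴴ * (X * (Bᴴ * B))).trace.re = frobeniusSq (X * Bᴴ) := by
    rw [frobeniusSq, Matrix.conjTranspose_mul, Matrix.conjTranspose_conjTranspose,
      Matrix.mul_assoc B, Matrix.trace_mul_comm B]
    simp only [Matrix.mul_assoc]
  have e0 : (Bᴴ * B)ᴴ = Bᴴ * B := Matrix.isHermitian_conjTranspose_mul_self B
  rw [frobeniusSq_smul_sub_smul, Real.sq_sqrt hg, Real.sq_sqrt hg', discriminantTerm,
    conjEntries_mul, Matrix.sub_mulVec, Matrix.smul_mulVec, Matrix.smul_mulVec,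
    Matrix.add_mulVec]
  -- The identity is written as its own conjugate to match the form `P ⊗ Q*`.
  nth_rewrite 1 [← conjEntries_one]
  rw [kronecker_conjEntries_mulVec, kronecker_conjEntries_mulVec, kronecker_conjEntries_mulVec,
    dotProduct_sub, dotProduct_smul, dotProduct_smul, dotProduct_add,
    star_vec_transpose_dotProduct, star_vec_transpose_dotProduct, star_vec_transpose_dotProduct,
    e1, Matrix.conjTranspose_one, Matrix.mul_one, Matrix.one_mul, e0, smul_eq_mul, smul_eq_mul, Complex.sub_re,
    Complex.re_ofReal_mul, Complex.re_ofReal_mul, Complex.add_re, e2, e3, Real.sqrt_mul hg]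
  ring

/-- The transition part `√(g g') B ⊗ B*` of a term of the discriminant proxy. -/
noncomputable def transitionPart (g g' : ℝ) (B : Matrix (Fin d) (Fin d) ℂ) :
    Matrix (Fin d × Fin d) (Fin d × Fin d) ℂ :=
  ((√(g * g') : ℝ) : ℂ) • (B ⊗ₖ conjEntries B)

/-- The decay part `(g/2) (B†B ⊗ I + I ⊗ B†* B*)` of a term of the discriminant proxy. -/
noncomputable def decayPart (g : ℝ) (B : Matrix (Fin d) (Fin d) ℂ) :
    Matrix (Fin d × Fin d) (Fin d × Fin d) ℂ :=
  ((g / 2 : ℝ) : ℂ) • ((Bᴴ * B) ⊗ₖ (1 : Matrix (Fin d) (Fin d) ℂ) +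
    (1 : Matrix (Fin d) (Fin d) ℂ) ⊗ₖ (conjEntries Bᴴ * conjEntries B))

lemma conjTranspose_discriminantTerm (g g' : ℝ) (B : Matrix (Fin d) (Fin d) ℂ) :
    (discriminantTerm g g' B)ᴴ = transitionPart g g' Bᴴ - decayPart g B := by
  have h : ∀ M : Matrix (Fin d) (Fin d) ℂ, (conjEntries M)ᴴ = conjEntries Mᴴ := fun M => rfl
  simp only [discriminantTerm, transitionPart, decayPart, Matrix.conjTranspose_sub,
    Matrix.conjTranspose_smul,
    Matrix.conjTranspose_add, Matrix.conjTranspose_kronecker, Matrix.conjTranspose_mul, h,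
    Matrix.conjTranspose_conjTranspose, Matrix.conjTranspose_one, RCLike.star_def,
    Complex.conj_ofReal]

end DiscriminantTerm

/-! ### Hermiticity and the Dirichlet form of the proxy -/

section Proxy

variable {d m : ℕ} {H : Matrix (Fin d) (Fin d) ℂ} {A : Fin m → Matrix (Fin d) (Fin d) ℂ}
  {σ : ℝ} {γ : ℝ → ℝ}

lemma aemeasurable_comp_neg (hγ : AEMeasurable γ) : AEMeasurable fun ω => γ (-ω) :=
  AEMeasurable.comp_quasiMeasurePreserving hγ
    (Measure.measurePreserving_neg (volume : Measure ℝ)).quasiMeasurePreserving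

lemma sqrt_mul_mem_unitInterval (h01 : ∀ ω, 0 ≤ γ ω ∧ γ ω ≤ 1) (ω : ℝ) :
    0 ≤ √(γ ω * γ (-ω)) ∧ √(γ ω * γ (-ω)) ≤ 1 :=
  ⟨Real.sqrt_nonneg _, Real.sqrt_le_one.2
    (mul_le_one₀ (h01 ω).2 (h01 (-ω)).1 (h01 (-ω)).2)⟩

lemma integrable_transitionPart (hH : H.IsHermitian) (hσ : 0 < σ) (hγ : AEMeasurable γ)
    (h01 : ∀ ω, 0 ≤ γ ω ∧ γ ω ≤ 1) (A : Matrix (Fin d) (Fin d) ℂ) (p q : Fin d × Fin d) :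
    Integrable fun ω =>
      transitionPart (γ ω) (γ (-ω)) (operatorFT H (gaussianFilter σ) A ω) p q :=
  (bddIntegrable_operatorFT hH A hσ p.1 q.1).integrable_weight_mul
    (bddIntegrable_operatorFT hH A hσ p.2 q.2).star
    (hγ.mul (aemeasurable_comp_neg hγ)).sqrt (sqrt_mul_mem_unitInterval h01)

lemma integrable_decayPart (hH : H.IsHermitian) (hσ : 0 < σ) (hγ : AEMeasurable γ)
    (h01 : ∀ ω, 0 ≤ γ ω ∧ γ ω ≤ 1) (A : Matrix (Fin d) (Fin d) ℂ) (p q : Fin d × Fin d) :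
    Integrable fun ω => decayPart (γ ω) (operatorFT H (gaussianFilter σ) A ω) p q := by
  have hB := fun i j => bddIntegrable_operatorFT hH A hσ i j
  have h1 : ∀ i j, Integrable fun ω => (γ ω : ℂ) *
      ((operatorFT H (gaussianFilter σ) A ω)ᴴ * operatorFT H (gaussianFilter σ) A ω) i j := by
    intro i j
    simp_rw [Matrix.mul_apply, Finset.mul_sum]
    exact integrable_finsetSum _ fun k _ => (hB k i).star.integrable_weight_mul (hB k j) hγ h01
  have h2 : ∀ i j, Integrable fun ω => (γ ω : ℂ) *
      (conjEntries (operatorFT H (gaussianFilter σ) A ω)ᴴ *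
        conjEntries (operatorFT H (gaussianFilter σ) A ω)) i j := by
    intro i j
    simp_rw [Matrix.mul_apply, Finset.mul_sum]
    refine integrable_finsetSum _ fun k _ =>
      ((hB k i).star.star.integrable_weight_mul (hB k j).star hγ h01)
  refine (((h1 p.1 q.1).mul_const ((1 : Matrix (Fin d) (Fin d) ℂ) p.2 q.2)).add
    ((h2 p.2 q.2).const_mul ((1 : Matrix (Fin d) (Fin d) ℂ) p.1 q.1))).const_mul (1 / 2) |>.congr
    (Filter.Eventually.of_forall fun ω => ?_)
  simp only [decayPart, Pi.add_apply, Matrix.smul_apply, Matrix.add_apply, Matrix.kroneckerMap_apply,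
    smul_eq_mul]
  push_cast
  ring

lemma integrable_discriminantTerm (hH : H.IsHermitian) (hσ : 0 < σ) (hγ : AEMeasurable γ)
    (h01 : ∀ ω, 0 ≤ γ ω ∧ γ ω ≤ 1) (A : Matrix (Fin d) (Fin d) ℂ) (p q : Fin d × Fin d) :
    Integrable fun ω =>
      discriminantTerm (γ ω) (γ (-ω)) (operatorFT H (gaussianFilter σ) A ω) p q :=
  (integrable_transitionPart hH hσ hγ h01 A p q).sub (integrable_decayPart hH hσ hγ h01 A p q)

/-- The decay part is self-adjoint pointwise. The adjoint of the transition part is the one of jump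
`P a` at `-ω`; its weight is even in `ω`, so reflecting the integral and permuting the sum restores
it. -/
theorem isHermitian_discriminantProxy (hH : H.IsHermitian) (hσ : 0 < σ) (hγ : AEMeasurable γ)
    (h01 : ∀ ω, 0 ≤ γ ω ∧ γ ω ≤ 1) {P : Equiv.Perm (Fin m)} (hP : ∀ a, A (P a) = (A a)ᴴ) :
    (discriminantProxy H A (gaussianFilter σ) γ).IsHermitian := by
  set B := fun a ω => operatorFT H (gaussianFilter σ) (A a) ω
  have hB : ∀ a ω, (B a ω)ᴴ = B (P a) (-ω) := fun a ω => by
    simp only [B, hP, conjTranspose_operatorFT hH _ hσ]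
  ext p q
  have ht := fun a => integrable_transitionPart hH hσ hγ h01 (A a) p q
  have hd := fun a => integrable_decayPart hH hσ hγ h01 (A a) p q
  have e1 : ∀ a, ∫ ω, discriminantTerm (γ ω) (γ (-ω)) (B a ω) p q =
      (∫ ω, transitionPart (γ ω) (γ (-ω)) (B a ω) p q) - ∫ ω, decayPart (γ ω) (B a ω) p q :=
    fun a => integral_sub (ht a) (hd a)
  have e2 : ∀ a, star (∫ ω, discriminantTerm (γ ω) (γ (-ω)) (B a ω) q p) =
      (∫ ω, transitionPart (γ ω) (γ (-ω)) (B (P a) ω) p q) - ∫ ω, decayPart (γ ω) (B a ω) p q := by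
    intro a
    -- The weight is written with `- -ω` so that the transition part is literally a function
    -- evaluated at `-ω`.
    have hs : ∀ ω, star (discriminantTerm (γ ω) (γ (-ω)) (B a ω) q p) =
        transitionPart (γ (-ω)) (γ (- -ω)) (B (P a) (-ω)) p q - decayPart (γ ω) (B a ω) p q := by
      intro ω
      rw [← Matrix.conjTranspose_apply, conjTranspose_discriminantTerm, Matrix.sub_apply, hB,
        neg_neg, transitionPart, transitionPart, mul_comm (γ (-ω))]
    rw [RCLike.star_def, ← integral_conj]
    simp_rw [← RCLike.star_def, hs]
    rw [integral_sub (ht (P a)).comp_neg (hd a),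
      integral_neg_eq_self fun ω => transitionPart (γ ω) (γ (-ω)) (B (P a) ω) p q]
  rw [Matrix.conjTranspose_apply]
  change star (∑ a, ∫ ω, discriminantTerm (γ ω) (γ (-ω)) (B a ω) q p) =
    ∑ a, ∫ ω, discriminantTerm (γ ω) (γ (-ω)) (B a ω) p q
  rw [star_sum]
  simp_rw [e1, e2, Finset.sum_sub_distrib]
  congr 1
  exact Equiv.sum_comp P fun a => ∫ ω, transitionPart (γ ω) (γ (-ω)) (B a ω) p q

lemma integrable_weight_mul_frobeniusSq {M : ℝ → Matrix (Fin d) (Fin d) ℂ}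
    (hM : ∀ i j, BddIntegrable fun ω => M ω i j) (hγ : AEMeasurable γ)
    (h01 : ∀ ω, 0 ≤ γ ω ∧ γ ω ≤ 1) : Integrable fun ω => γ ω * frobeniusSq (M ω) := by
  simp_rw [frobeniusSq_eq_sum, Finset.mul_sum]
  refine integrable_finsetSum _ fun j _ => integrable_finsetSum _ fun i _ => ?_
  refine ((hM i j).star.integrable_weight_mul (hM i j) hγ h01).re.congr
    (Filter.Eventually.of_forall fun ω => ?_)
  simp only [RCLike.star_def, ← Complex.normSq_eq_conj_mul_self, ← Complex.ofReal_mul,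
    Complex.normSq_eq_norm_sq, RCLike.re_eq_complex_re, Complex.ofReal_re]

theorem re_discriminantProxy_form (hH : H.IsHermitian) (hσ : 0 < σ) (hγ : AEMeasurable γ)
    (h01 : ∀ ω, 0 ≤ γ ω ∧ γ ω ≤ 1) {P : Equiv.Perm (Fin m)} (hP : ∀ a, A (P a) = (A a)ᴴ)
    (X : Matrix (Fin d) (Fin d) ℂ) :
    (star (Matrix.vec Xᵀ) ⬝ᵥ
      (discriminantProxy H A (gaussianFilter σ) γ *ᵥ Matrix.vec Xᵀ)).re =
    -(1 / 2) * ∑ a, ∫ ω, frobeniusSq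
      (((√(γ ω) : ℝ) : ℂ) • (operatorFT H (gaussianFilter σ) (A a) ω * X) -
        ((√(γ (-ω)) : ℝ) : ℂ) • (X * operatorFT H (gaussianFilter σ) (A a) ω)) := by
  set B := fun a ω => operatorFT H (gaussianFilter σ) (A a) ω with hBdef
  set x := Matrix.vec Xᵀ
  have hB := fun a i j => bddIntegrable_operatorFT hH (A a) hσ i j
  have hterm := fun a p q => integrable_discriminantTerm hH hσ hγ h01 (A a) p q
  have hform : ∀ a ω, star x ⬝ᵥ (discriminantTerm (γ ω) (γ (-ω)) (B a ω) *ᵥ x) =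
      ∑ p, ∑ q, star (x p) * x q * discriminantTerm (γ ω) (γ (-ω)) (B a ω) p q := by
    intro a ω
    simp only [dotProduct, Matrix.mulVec, Finset.mul_sum, Pi.star_apply]
    refine Finset.sum_congr rfl fun p _ => Finset.sum_congr rfl fun q _ => ?_
    ring
  have hint : ∀ a, Integrable fun ω =>
      star x ⬝ᵥ (discriminantTerm (γ ω) (γ (-ω)) (B a ω) *ᵥ x) := by
    intro a
    simp_rw [hform]
    exact integrable_finsetSum _ fun p _ => integrable_finsetSum _ fun q _ =>
      (hterm a p q).const_mul _
  have hsum : star x ⬝ᵥ (discriminantProxy H A (gaussianFilter σ) γ *ᵥ x) =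
      ∑ a, ∫ ω, star x ⬝ᵥ (discriminantTerm (γ ω) (γ (-ω)) (B a ω) *ᵥ x) := by
    simp_rw [hform]
    have : ∀ a, ∫ ω, ∑ p, ∑ q, star (x p) * x q *
          discriminantTerm (γ ω) (γ (-ω)) (B a ω) p q =
        ∑ p, ∑ q, star (x p) * x q *
          ∫ ω, discriminantTerm (γ ω) (γ (-ω)) (B a ω) p q := by
      intro a
      rw [integral_finsetSum _ fun p _ => integrable_finsetSum _ fun q _ =>
        (hterm a p q).const_mul _]
      refine Finset.sum_congr rfl fun p _ => ?_
      rw [integral_finsetSum _ fun q _ => (hterm a p q).const_mul _]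
      exact Finset.sum_congr rfl fun q _ => integral_const_mul _ _
    simp_rw [this]
    rw [Finset.sum_comm]
    simp only [dotProduct, Matrix.mulVec, Finset.mul_sum, Pi.star_apply, discriminantProxy,
      Matrix.of_apply, Finset.sum_mul]
    refine Finset.sum_congr rfl fun p _ => ?_
    rw [Finset.sum_comm]
    refine Finset.sum_congr rfl fun q _ => Finset.sum_congr rfl fun a _ => ?_
    ring
  have hleft : ∀ a, Integrable fun ω => γ (-ω) * frobeniusSq (X * B a ω) := fun a =>
    integrable_weight_mul_frobeniusSq (BddIntegrable.matrix_const_mul (hB a) X)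
      (aemeasurable_comp_neg hγ) fun ω => h01 (-ω)
  have hright : ∀ a, Integrable fun ω => γ ω * frobeniusSq (X * (B a ω)ᴴ) := fun a =>
    integrable_weight_mul_frobeniusSq
      (BddIntegrable.matrix_const_mul (fun i j => (hB a j i).star) X) hγ h01
  -- The remainder left by completing the square cancels through `B_a(ω)† = B_{P a}(-ω)`.
  have hswap : ∑ a, ∫ ω, γ (-ω) * frobeniusSq (X * B a ω) =
      ∑ a, ∫ ω, γ ω * frobeniusSq (X * (B a ω)ᴴ) := by
    rw [← Equiv.sum_comp P]
    refine Finset.sum_congr rfl fun a _ => ?_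
    rw [← integral_neg_eq_self]
    simp only [hBdef, neg_neg, hP, conjTranspose_operatorFT hH _ hσ]
  have hre : ∀ a ω, frobeniusSq (((√(γ ω) : ℝ) : ℂ) • (B a ω * X) -
      ((√(γ (-ω)) : ℝ) : ℂ) • (X * B a ω)) =
      -2 * (star x ⬝ᵥ (discriminantTerm (γ ω) (γ (-ω)) (B a ω) *ᵥ x)).re +
        (γ (-ω) * frobeniusSq (X * B a ω) - γ ω * frobeniusSq (X * (B a ω)ᴴ)) := by
    intro a ω
    rw [re_discriminantTerm_form (h01 ω).1 (h01 (-ω)).1]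
    ring
  change _ = -(1 / 2) * ∑ a, ∫ ω, frobeniusSq (((√(γ ω) : ℝ) : ℂ) • (B a ω * X) -
    ((√(γ (-ω)) : ℝ) : ℂ) • (X * B a ω))
  rw [hsum, Complex.re_sum]
  simp_rw [hre]
  have hsplit : ∀ a, ∫ ω, (-2 * (star x ⬝ᵥ
        (discriminantTerm (γ ω) (γ (-ω)) (B a ω) *ᵥ x)).re +
        (γ (-ω) * frobeniusSq (X * B a ω) - γ ω * frobeniusSq (X * (B a ω)ᴴ))) =
      -2 * (∫ ω, star x ⬝ᵥ (discriminantTerm (γ ω) (γ (-ω)) (B a ω) *ᵥ x)).re +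
        ((∫ ω, γ (-ω) * frobeniusSq (X * B a ω)) - ∫ ω, γ ω * frobeniusSq (X * (B a ω)ᴴ)) := by
    intro a
    have h1 : Integrable fun ω => -2 * (star x ⬝ᵥ
      (discriminantTerm (γ ω) (γ (-ω)) (B a ω) *ᵥ x)).re := (hint a).re.const_mul (-2)
    have h2 : Integrable fun ω => γ (-ω) * frobeniusSq (X * B a ω) -
      γ ω * frobeniusSq (X * (B a ω)ᴴ) := (hleft a).sub (hright a)
    rw [integral_add h1 h2, integral_const_mul,
      integral_sub (hleft a) (hright a)]
    congr 2
    exact integral_re (hint a)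
  simp_rw [hsplit]
  rw [Finset.sum_add_distrib, Finset.sum_sub_distrib, hswap, sub_self, add_zero, ← Finset.mul_sum]
  ring

end Proxy

/-! ### Perturbation of a top eigenvector under a spectral gap -/

section TopEigenvector

lemma toEuclideanLin_eigenvectorBasis {n : Type} [Fintype n] [DecidableEq n] {M : Matrix n n ℂ}
    (hM : M.IsHermitian) (k : n) :
    Matrix.toEuclideanLin M (hM.eigenvectorBasis k) =
      ((hM.eigenvalues k : ℝ) : ℂ) • hM.eigenvectorBasis k := by
  refine PiLp.ext fun i => ?_
  have h := congrFun (hM.mulVec_eigenvectorBasis k) i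
  rw [Matrix.toLpLin_apply]
  simpa using h

lemma inner_eigenvectorBasis_toEuclideanLin {n : Type} [Fintype n] [DecidableEq n]
    {M : Matrix n n ℂ} (hM : M.IsHermitian) (k : n) (x : EuclideanSpace ℂ n) :
    inner ℂ (hM.eigenvectorBasis k) (Matrix.toEuclideanLin M x) =
      ((hM.eigenvalues k : ℝ) : ℂ) * inner ℂ (hM.eigenvectorBasis k) x := by
  rw [← Matrix.isSymmetric_toEuclideanLin_iff.mpr hM, toEuclideanLin_eigenvectorBasis,
    inner_smul_left, Complex.conj_ofReal]

/-- Off the line of a top eigenvector, the quadratic form of a Hermitian matrix drops at least by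
the spectral gap. -/
lemma re_inner_toEuclideanLin_le_of_top_eigenvector {n : Type} [Fintype n] [DecidableEq n]
    {M : Matrix n n ℂ} (hM : M.IsHermitian) (hn : 1 < Fintype.card n) (hgap : 0 < spectralGap hM)
    {v : EuclideanSpace ℂ n} (hv : ‖v‖ = 1)
    (hMv : Matrix.toEuclideanLin M v = ((sortedEigenvalue hM 0 : ℝ) : ℂ) • v)
    (x : EuclideanSpace ℂ n) :
    (inner ℂ x (Matrix.toEuclideanLin M x)).re ≤ sortedEigenvalue hM 0 * ‖x‖ ^ 2 -
      spectralGap hM * (‖x‖ ^ 2 - ‖inner ℂ v x‖ ^ 2) := by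
  set b := hM.eigenvectorBasis
  -- This is the enumeration by which `Matrix.IsHermitian.eigenvalues` is defined, so `k₀` indexes
  -- the largest eigenvalue.
  let e : Fin (Fintype.card n) ≃ n := Fintype.equivOfCardEq (Fintype.card_fin _)
  let k₀ : n := e ⟨0, by omega⟩
  have h0 : hM.eigenvalues k₀ = sortedEigenvalue hM 0 := by
    rw [sortedEigenvalue, dif_pos (by omega), Matrix.IsHermitian.eigenvalues]
    congr 1
    exact e.symm_apply_apply _
  have h1 : ∀ k, k ≠ k₀ → hM.eigenvalues k ≤ sortedEigenvalue hM 1 := by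
    intro k hk
    rw [sortedEigenvalue, dif_pos hn, Matrix.IsHermitian.eigenvalues]
    refine hM.eigenvalues₀_antitone ?_
    have : e.symm k ≠ ⟨0, by omega⟩ := fun h => hk (e.symm_apply_eq.1 h)
    rw [Fin.le_def]
    have h2 : (e.symm k : ℕ) ≠ 0 := fun h => this (Fin.ext h)
    exact Nat.one_le_iff_ne_zero.2 h2
  have hgap' : sortedEigenvalue hM 1 < sortedEigenvalue hM 0 := sub_pos.1 hgap
  -- A positive gap makes the top eigenvalue simple, so `v` is a phase times `b k₀`.
  have horth : ∀ k, k ≠ k₀ → inner ℂ (b k) v = 0 := by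
    intro k hk
    have h := inner_eigenvectorBasis_toEuclideanLin hM k v
    rw [hMv, inner_smul_right, ← sub_eq_zero, ← sub_mul, ← Complex.ofReal_sub] at h
    refine (mul_eq_zero.1 h).resolve_left ?_
    have := h1 k hk
    exact_mod_cast (by linarith : 0 < sortedEigenvalue hM 0 - hM.eigenvalues k).ne'
  have hv0 : ‖inner ℂ (b k₀) v‖ ^ 2 = 1 := by
    have h := b.sum_sq_norm_inner_right v
    rwa [Finset.sum_eq_single k₀ (fun k _ hk => by rw [horth k hk]; simp) (by simp), hv,
      one_pow] at h
  have hvx : ‖inner ℂ v x‖ ^ 2 = ‖inner ℂ (b k₀) x‖ ^ 2 := by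
    rw [← b.sum_inner_mul_inner v x, Finset.sum_eq_single k₀ (fun k _ hk => by
      rw [← inner_conj_symm, horth k hk]; simp) (by simp), norm_mul, mul_pow, norm_inner_symm, hv0,
      one_mul]
  have hform : (inner ℂ x (Matrix.toEuclideanLin M x)).re =
      ∑ k, hM.eigenvalues k * ‖inner ℂ (b k) x‖ ^ 2 := by
    rw [← b.sum_inner_mul_inner x, Complex.re_sum]
    refine Finset.sum_congr rfl fun k _ => ?_
    rw [inner_eigenvectorBasis_toEuclideanLin, mul_left_comm, Complex.re_ofReal_mul,
      ← inner_conj_symm x, ← Complex.normSq_eq_conj_mul_self, Complex.ofReal_re,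
      Complex.normSq_eq_norm_sq]
  have hnorm := b.sum_sq_norm_inner_right x
  rw [hform, hvx, ← hnorm, ← Finset.add_sum_erase _ _ (Finset.mem_univ k₀),
    ← Finset.add_sum_erase (a := k₀) _ (fun k => ‖inner ℂ (b k) x‖ ^ 2) (Finset.mem_univ k₀), h0,
    add_sub_cancel_left, spectralGap]
  have : ∑ k ∈ Finset.univ.erase k₀, hM.eigenvalues k * ‖inner ℂ (b k) x‖ ^ 2 ≤
      sortedEigenvalue hM 1 * ∑ k ∈ Finset.univ.erase k₀, ‖inner ℂ (b k) x‖ ^ 2 := by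
    rw [Finset.mul_sum]
    exact Finset.sum_le_sum fun k hk =>
      mul_le_mul_of_nonneg_right (h1 k (Finset.ne_of_mem_erase hk)) (sq_nonneg _)
  linarith

/-- Rotating `v` so that its overlap `c` with `r` becomes `|c|` gives squared distance `2 - 2|c|`,
and `|c|² ≤ |c|` for unit vectors. -/
lemma exists_phase_norm_sub_sq_le {V : Type*} [NormedAddCommGroup V] [InnerProductSpace ℂ V]
    {v r : V} (hv : ‖v‖ = 1) (hr : ‖r‖ = 1) :
    ∃ z : ℂ, ‖z‖ = 1 ∧ ‖z • v - r‖ ^ 2 ≤ 2 * (1 - ‖inner ℂ v r‖ ^ 2) := by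
  obtain ⟨z, hz, hzc⟩ : ∃ z : ℂ, ‖z‖ = 1 ∧ (starRingEnd ℂ z * inner ℂ v r).re = ‖inner ℂ v r‖ := by
    generalize inner ℂ v r = c
    rcases eq_or_ne c 0 with rfl | hc
    · exact ⟨1, by simp⟩
    · have hn : (‖c‖ : ℂ) ≠ 0 := by simpa using hc
      refine ⟨c / ‖c‖, by simp [hc], ?_⟩
      rw [map_div₀, Complex.conj_ofReal, div_mul_eq_mul_div, ← Complex.normSq_eq_conj_mul_self,
        Complex.normSq_eq_norm_sq, ← Complex.ofReal_div, Complex.ofReal_re, sq,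
        mul_self_div_self]
  refine ⟨z, hz, ?_⟩
  have hc1 : ‖inner ℂ v r‖ ≤ 1 := by simpa [hv, hr] using norm_inner_le_norm (𝕜 := ℂ) v r
  rw [norm_sub_sq (𝕜 := ℂ), inner_smul_left, norm_smul, hz, hv, hr, RCLike.re_eq_complex_re, hzc]
  nlinarith [norm_nonneg (inner ℂ v r)]

lemma exists_phase_norm_sub_le_of_form_bounds {n : Type} [Fintype n] [DecidableEq n]
    {M : Matrix n n ℂ} (hM : M.IsHermitian) (hn : 1 < Fintype.card n) (hgap : 0 < spectralGap hM)
    {v : EuclideanSpace ℂ n} (hv : ‖v‖ = 1)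
    (hMv : Matrix.toEuclideanLin M v = ((sortedEigenvalue hM 0 : ℝ) : ℂ) • v)
    (hneg : ∀ x, (inner ℂ x (Matrix.toEuclideanLin M x)).re ≤ 0)
    {e : Fin 2 → EuclideanSpace ℂ n} (he : Orthonormal ℂ e)
    (he' : ∀ i, -1 ≤ (inner ℂ (e i) (Matrix.toEuclideanLin M (e i))).re)
    {r : EuclideanSpace ℂ n} (hr : ‖r‖ = 1) {ε : ℝ} (hε : 0 ≤ ε)
    (hr' : -ε ^ 2 ≤ (inner ℂ r (Matrix.toEuclideanLin M r)).re) :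
    ∃ z : ℂ, ‖z‖ = 1 ∧ ‖z • v - r‖ ≤ 2 * ε / spectralGap hM := by
  have hform := re_inner_toEuclideanLin_le_of_top_eigenvector hM hn hgap hv hMv
  have htop : sortedEigenvalue hM 0 ≤ 0 := by
    have h := hneg v
    rw [hMv, inner_smul_right, inner_self_eq_norm_sq_to_K, hv] at h
    simpa using h
  have hbessel : ‖inner ℂ v (e 0)‖ ^ 2 + ‖inner ℂ v (e 1)‖ ^ 2 ≤ 1 := by
    have h := he.sum_inner_products_le v (s := Finset.univ)
    rw [Fin.sum_univ_two, hv, one_pow] at h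
    rwa [norm_inner_symm v, norm_inner_symm v]
  -- Add the two gap inequalities at `e 0` and `e 1`: by Bessel they lose at least `gap` in total,
  -- while the top eigenvalue is at most `0`.
  have hgap2 : spectralGap hM ≤ 2 := by
    have h0 := (he' 0).trans (hform (e 0))
    have h1 := (he' 1).trans (hform (e 1))
    rw [he.1, one_pow, mul_one] at h0 h1
    nlinarith
  obtain ⟨z, hz, hzr⟩ := exists_phase_norm_sub_sq_le hv hr
  refine ⟨z, hz, ?_⟩
  have h := hr'.trans (hform r)
  rw [hr, one_pow, mul_one] at h
  refine le_of_sq_le_sq ?_ (by positivity)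
  rw [div_pow, le_div_iff₀ (by positivity)]
  have h2 : spectralGap hM * (1 - ‖inner ℂ v r‖ ^ 2) ≤ ε ^ 2 := by linarith
  calc ‖z • v - r‖ ^ 2 * spectralGap hM ^ 2
      ≤ 2 * (1 - ‖inner ℂ v r‖ ^ 2) * spectralGap hM ^ 2 := by gcongr
    _ = 2 * spectralGap hM * (spectralGap hM * (1 - ‖inner ℂ v r‖ ^ 2)) := by ring
    _ ≤ 2 * spectralGap hM * ε ^ 2 := by gcongr
    _ ≤ (2 * ε) ^ 2 := by nlinarith [sq_nonneg ε]

end TopEigenvector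

/-! ### States diagonal in the energy eigenbasis -/

section DiagonalStates

variable {d m : ℕ} {H : Matrix (Fin d) (Fin d) ℂ} {A : Fin m → Matrix (Fin d) (Fin d) ℂ}
  {σ β : ℝ} {γ : ℝ → ℝ}

lemma inner_toEuclideanLin_toLp {n : Type*} [Fintype n] [DecidableEq n] (M : Matrix n n ℂ)
    (w : n → ℂ) : inner ℂ (WithLp.toLp 2 w) (Matrix.toEuclideanLin M (WithLp.toLp 2 w)) =
      star w ⬝ᵥ (M *ᵥ w) := by
  rw [Matrix.toLpLin_toLp, EuclideanSpace.inner_toLp_toLp, dotProduct_comm]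
  rfl

/-- The vectorization of the operator that is diagonal in the eigenbasis of `H`, with entries `x`. -/
noncomputable def diagonalState (hH : H.IsHermitian) (x : Fin d → ℝ) :
    EuclideanSpace ℂ (Fin d × Fin d) :=
  WithLp.toLp 2 (Matrix.vec ((hH.eigenvectorUnitary : Matrix (Fin d) (Fin d) ℂ) *
    Matrix.diagonal (fun k => (x k : ℂ)) * (hH.eigenvectorUnitary : Matrix (Fin d) (Fin d) ℂ)ᴴ)ᵀ)

lemma inner_diagonalState (hH : H.IsHermitian) (x y : Fin d → ℝ) :
    inner ℂ (diagonalState hH x) (diagonalState hH y) = ((∑ k, x k * y k : ℝ) : ℂ) := by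
  obtain ⟨hU, -⟩ := exists_diagonalization hH
  set U := (hH.eigenvectorUnitary : Matrix (Fin d) (Fin d) ℂ)
  have e : (U * Matrix.diagonal (fun k => (x k : ℂ)) * Uᴴ)ᴴ *
      (U * Matrix.diagonal (fun k => (y k : ℂ)) * Uᴴ) =
      U * (Matrix.diagonal (fun k => (x k : ℂ)) * (Uᴴ * U) *
        Matrix.diagonal (fun k => (y k : ℂ)) * Uᴴ) := by
    have : (Matrix.diagonal (fun k => (x k : ℂ)))ᴴ = Matrix.diagonal (fun k => (x k : ℂ)) := by
      rw [Matrix.diagonal_conjTranspose]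
      congr 1
      funext k
      simp
    simp only [Matrix.conjTranspose_mul, Matrix.conjTranspose_conjTranspose, Matrix.mul_assoc, this]
  rw [diagonalState, diagonalState, EuclideanSpace.inner_toLp_toLp, dotProduct_comm,
    star_vec_transpose_dotProduct, e, Matrix.trace_mul_comm, hU, Matrix.mul_one, Matrix.mul_assoc,
    hU, Matrix.mul_one, Matrix.diagonal_mul_diagonal, Matrix.trace_diagonal]
  push_cast
  rfl

lemma sum_norm_sq_column_le_one (hH : H.IsHermitian)
    (hA : ‖Matrix.toEuclideanCLM (n := Fin d) (𝕜 := ℂ) (∑ a, (A a)ᴴ * A a)‖ ≤ 1) (l : Fin d) :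
    ∑ a, ∑ k, ‖((hH.eigenvectorUnitary : Matrix (Fin d) (Fin d) ℂ)ᴴ * A a *
      (hH.eigenvectorUnitary : Matrix (Fin d) (Fin d) ℂ)) k l‖ ^ 2 ≤ 1 := by
  obtain ⟨hU, -⟩ := exists_diagonalization hH
  set U := (hH.eigenvectorUnitary : Matrix (Fin d) (Fin d) ℂ)
  have hU' : U * Uᴴ = 1 := mul_eq_one_comm.1 hU
  set u := hH.eigenvectorBasis l
  have h1 : ((∑ a, ∑ k, ‖(Uᴴ * A a * U) k l‖ ^ 2 : ℝ) : ℂ) = (Uᴴ * (∑ a, (A a)ᴴ * A a) * U) l l := by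
    rw [Matrix.mul_sum, Matrix.sum_mul, Matrix.sum_apply, Complex.ofReal_sum]
    refine Finset.sum_congr rfl fun a _ => ?_
    have : Uᴴ * ((A a)ᴴ * A a) * U = (Uᴴ * A a * U)ᴴ * (Uᴴ * A a * U) := by
      have e : (Uᴴ * A a * U)ᴴ * (Uᴴ * A a * U) = Uᴴ * (A a)ᴴ * (U * Uᴴ) * A a * U := by
        simp only [Matrix.conjTranspose_mul, Matrix.conjTranspose_conjTranspose, Matrix.mul_assoc]
      rw [e, hU', Matrix.mul_one]
      simp only [Matrix.mul_assoc]
    rw [this, Matrix.mul_apply, Complex.ofReal_sum]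
    refine Finset.sum_congr rfl fun k _ => ?_
    rw [Matrix.conjTranspose_apply, RCLike.star_def, ← Complex.normSq_eq_conj_mul_self,
      Complex.normSq_eq_norm_sq]
  have h2 : (Uᴴ * (∑ a, (A a)ᴴ * A a) * U) l l =
      inner ℂ u (Matrix.toEuclideanCLM (n := Fin d) (𝕜 := ℂ) (∑ a, (A a)ᴴ * A a) u) := by
    rw [EuclideanSpace.inner_eq_star_dotProduct, Matrix.ofLp_toEuclideanCLM, dotProduct_comm,
      Matrix.mul_assoc, Matrix.mul_apply]
    rfl
  have h3 : ‖((∑ a, ∑ k, ‖(Uᴴ * A a * U) k l‖ ^ 2 : ℝ) : ℂ)‖ ≤ 1 := by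
    rw [h1, h2]
    refine (norm_inner_le_norm _ _).trans ?_
    have hn : ‖u‖ = 1 := hH.eigenvectorBasis.orthonormal.1 l
    refine (mul_le_mul_of_nonneg_left (ContinuousLinearMap.le_opNorm _ _) (norm_nonneg _)).trans ?_
    rwa [hn, one_mul, mul_one]
  rw [Complex.norm_real] at h3
  exact (le_abs_self _).trans h3

/-- The normalization controls columns only; closure under adjoints turns rows into columns. -/
lemma sum_norm_sq_row_le_one (hH : H.IsHermitian) {P : Equiv.Perm (Fin m)}
    (hP : ∀ a, A (P a) = (A a)ᴴ)
    (hA : ‖Matrix.toEuclideanCLM (n := Fin d) (𝕜 := ℂ) (∑ a, (A a)ᴴ * A a)‖ ≤ 1) (k : Fin d) :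
    ∑ a, ∑ l, ‖((hH.eigenvectorUnitary : Matrix (Fin d) (Fin d) ℂ)ᴴ * A a *
      (hH.eigenvectorUnitary : Matrix (Fin d) (Fin d) ℂ)) k l‖ ^ 2 ≤ 1 := by
  refine le_of_eq_of_le ?_ (sum_norm_sq_column_le_one hH hA k)
  rw [← Equiv.sum_comp P]
  refine Finset.sum_congr rfl fun a _ => Finset.sum_congr rfl fun l _ => ?_
  have : (hH.eigenvectorUnitary : Matrix (Fin d) (Fin d) ℂ)ᴴ * (A a)ᴴ *
      (hH.eigenvectorUnitary : Matrix (Fin d) (Fin d) ℂ) =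
      ((hH.eigenvectorUnitary : Matrix (Fin d) (Fin d) ℂ)ᴴ * A a *
      (hH.eigenvectorUnitary : Matrix (Fin d) (Fin d) ℂ))ᴴ := by
    simp only [Matrix.conjTranspose_mul, Matrix.conjTranspose_conjTranspose, Matrix.mul_assoc]
  rw [hP, this, Matrix.conjTranspose_apply, norm_star]

lemma re_inner_discriminantProxy_nonpos (hH : H.IsHermitian) (hσ : 0 < σ) (hγ : AEMeasurable γ)
    (h01 : ∀ ω, 0 ≤ γ ω ∧ γ ω ≤ 1) {P : Equiv.Perm (Fin m)} (hP : ∀ a, A (P a) = (A a)ᴴ)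
    (v : EuclideanSpace ℂ (Fin d × Fin d)) :
    (inner ℂ v (Matrix.toEuclideanLin (discriminantProxy H A (gaussianFilter σ) γ) v)).re ≤ 0 := by
  have hv : v = WithLp.toLp 2 (Matrix.vec (Matrix.of fun i j => v (i, j))ᵀ) := rfl
  rw [hv, inner_toEuclideanLin_toLp, re_discriminantProxy_form hH hσ hγ h01 hP]
  have : 0 ≤ ∑ a, ∫ ω, frobeniusSq
      (((√(γ ω) : ℝ) : ℂ) • (operatorFT H (gaussianFilter σ) (A a) ω *
        Matrix.of fun i j => v (i, j)) - ((√(γ (-ω)) : ℝ) : ℂ) •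
        ((Matrix.of fun i j => v (i, j)) * operatorFT H (gaussianFilter σ) (A a) ω)) :=
    Finset.sum_nonneg fun a _ => integral_nonneg fun ω => frobeniusSq_nonneg _
  linarith

lemma frobeniusSq_commutator_diagonal (hH : H.IsHermitian) (hσ : 0 < σ) (x : Fin d → ℝ)
    (A : Matrix (Fin d) (Fin d) ℂ) (g g' ω : ℝ) :
    frobeniusSq ((g : ℂ) • (operatorFT H (gaussianFilter σ) A ω *
        ((hH.eigenvectorUnitary : Matrix (Fin d) (Fin d) ℂ) * Matrix.diagonal (fun k => (x k : ℂ)) *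
          (hH.eigenvectorUnitary : Matrix (Fin d) (Fin d) ℂ)ᴴ)) -
      (g' : ℂ) • ((hH.eigenvectorUnitary : Matrix (Fin d) (Fin d) ℂ) *
        Matrix.diagonal (fun k => (x k : ℂ)) *
          (hH.eigenvectorUnitary : Matrix (Fin d) (Fin d) ℂ)ᴴ *
            operatorFT H (gaussianFilter σ) A ω)) =
      ∑ l, ∑ k, ‖((hH.eigenvectorUnitary : Matrix (Fin d) (Fin d) ℂ)ᴴ * A *
        (hH.eigenvectorUnitary : Matrix (Fin d) (Fin d) ℂ)) k l‖ ^ 2 *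
          (gaussianFilter (1 / (2 * σ)) (ω - (hH.eigenvalues k - hH.eigenvalues l)) ^ 2 *
            (g * x l - g' * x k) ^ 2) := by
  obtain ⟨hU, hdiag⟩ := exists_diagonalization hH
  rw [operatorFT_of_diagonalization hU hdiag A hσ]
  set U := (hH.eigenvectorUnitary : Matrix (Fin d) (Fin d) ℂ)
  set N : Matrix (Fin d) (Fin d) ℂ := Matrix.of fun k l =>
    (gaussianFilter (1 / (2 * σ)) (ω - (hH.eigenvalues k - hH.eigenvalues l)) : ℂ) *
      (Uᴴ * A * U) k l with hN
  set D := Matrix.diagonal (fun k => (x k : ℂ)) with hD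
  have e : (g : ℂ) • (U * N * Uᴴ * (U * D * Uᴴ)) - (g' : ℂ) • (U * D * Uᴴ * (U * N * Uᴴ)) =
      U * ((g : ℂ) • (N * D) - (g' : ℂ) • (D * N)) * Uᴴ := by
    have h1 : U * N * Uᴴ * (U * D * Uᴴ) = U * (N * (Uᴴ * U) * D) * Uᴴ := by
      simp only [Matrix.mul_assoc]
    have h2 : U * D * Uᴴ * (U * N * Uᴴ) = U * (D * (Uᴴ * U) * N) * Uᴴ := by
      simp only [Matrix.mul_assoc]
    rw [h1, h2, hU, Matrix.mul_one, Matrix.mul_one, Matrix.mul_sub, Matrix.sub_mul,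
      Matrix.mul_smul, Matrix.mul_smul, Matrix.smul_mul, Matrix.smul_mul]
  rw [e, frobeniusSq_conj hU, frobeniusSq_eq_sum]
  refine Finset.sum_congr rfl fun l _ => Finset.sum_congr rfl fun k _ => ?_
  have e2 : ((g : ℂ) • (N * D) - (g' : ℂ) • (D * N)) k l =
      ((gaussianFilter (1 / (2 * σ)) (ω - (hH.eigenvalues k - hH.eigenvalues l)) *
        (g * x l - g' * x k) : ℝ) : ℂ) * (Uᴴ * A * U) k l := by
    rw [Matrix.sub_apply, Matrix.smul_apply, Matrix.smul_apply, hD, Matrix.mul_diagonal,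
      Matrix.diagonal_mul, hN, Matrix.of_apply, smul_eq_mul, smul_eq_mul]
    push_cast
    ring
  rw [e2, norm_mul, Complex.norm_real, mul_pow, Real.norm_eq_abs, sq_abs]
  ring

/-- A pointwise bound splitting as `xₗ² + xₖ²` times a function of the energy mismatch lets the
frequency integral factor out. The column and row sums contribute `1` each, cancelling the `1/2` of
the Dirichlet form. -/
lemma neg_integral_le_re_inner_diagonalState (hH : H.IsHermitian) (hσ : 0 < σ)
    (hγ : AEMeasurable γ) (h01 : ∀ ω, 0 ≤ γ ω ∧ γ ω ≤ 1) {P : Equiv.Perm (Fin m)}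
    (hP : ∀ a, A (P a) = (A a)ᴴ)
    (hA : ‖Matrix.toEuclideanCLM (n := Fin d) (𝕜 := ℂ) (∑ a, (A a)ᴴ * A a)‖ ≤ 1)
    {x : Fin d → ℝ} (hx : ∑ k, x k ^ 2 = 1) {h : ℝ → ℝ}
    (hint : Integrable fun u => gaussianFilter (1 / (2 * σ)) u ^ 2 * h u)
    (hh : ∀ u, 0 ≤ h u)
    (hxh : ∀ ω k l, (√(γ ω) * x l - √(γ (-ω)) * x k) ^ 2 ≤
      (x l ^ 2 + x k ^ 2) * h (ω - (hH.eigenvalues k - hH.eigenvalues l))) :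
    -∫ u, gaussianFilter (1 / (2 * σ)) u ^ 2 * h u ≤
      (inner ℂ (diagonalState hH x) (Matrix.toEuclideanLin
        (discriminantProxy H A (gaussianFilter σ) γ) (diagonalState hH x))).re := by
  set I := ∫ u, gaussianFilter (1 / (2 * σ)) u ^ 2 * h u with hI
  have hI0 : 0 ≤ I := integral_nonneg fun u => mul_nonneg (sq_nonneg _) (hh u)
  rw [diagonalState, inner_toEuclideanLin_toLp, re_discriminantProxy_form hH hσ hγ h01 hP]
  simp_rw [frobeniusSq_commutator_diagonal hH hσ x]
  set T := fun a => (hH.eigenvectorUnitary : Matrix (Fin d) (Fin d) ℂ)ᴴ * A a *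
        (hH.eigenvectorUnitary : Matrix (Fin d) (Fin d) ℂ)
  have hbound : ∀ a, ∫ ω, ∑ l, ∑ k, ‖T a k l‖ ^ 2 *
      (gaussianFilter (1 / (2 * σ)) (ω - (hH.eigenvalues k - hH.eigenvalues l)) ^ 2 *
        (√(γ ω) * x l - √(γ (-ω)) * x k) ^ 2) ≤
      ∑ l, ∑ k, ‖T a k l‖ ^ 2 * (x l ^ 2 + x k ^ 2) * I := by
    intro a
    have hi : ∀ l k, Integrable fun ω => ‖T a k l‖ ^ 2 * (x l ^ 2 + x k ^ 2) *
        (gaussianFilter (1 / (2 * σ)) (ω - (hH.eigenvalues k - hH.eigenvalues l)) ^ 2 *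
          h (ω - (hH.eigenvalues k - hH.eigenvalues l))) := fun l k =>
      (hint.comp_sub_right (hH.eigenvalues k - hH.eigenvalues l)).const_mul _
    have e : ∑ l, ∑ k, ‖T a k l‖ ^ 2 * (x l ^ 2 + x k ^ 2) * I =
        ∫ ω, ∑ l, ∑ k, ‖T a k l‖ ^ 2 * (x l ^ 2 + x k ^ 2) *
          (gaussianFilter (1 / (2 * σ)) (ω - (hH.eigenvalues k - hH.eigenvalues l)) ^ 2 *
            h (ω - (hH.eigenvalues k - hH.eigenvalues l))) := by
      rw [integral_finsetSum _ fun l _ => integrable_finsetSum _ fun k _ => hi l k]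
      refine Finset.sum_congr rfl fun l _ => ?_
      rw [integral_finsetSum _ fun k _ => hi l k]
      refine Finset.sum_congr rfl fun k _ => ?_
      rw [integral_const_mul, integral_sub_right_eq_self
        (fun u => gaussianFilter (1 / (2 * σ)) u ^ 2 * h u)]
    rw [e]
    refine integral_mono_of_nonneg (Filter.Eventually.of_forall fun ω => ?_)
      (integrable_finsetSum _ fun l _ => integrable_finsetSum _ fun k _ => hi l k)
      (Filter.Eventually.of_forall fun ω => ?_)
    · exact Finset.sum_nonneg fun l _ => Finset.sum_nonneg fun k _ => by positivity
    · refine Finset.sum_le_sum fun l _ => Finset.sum_le_sum fun k _ => ?_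
      rw [mul_assoc]
      refine mul_le_mul_of_nonneg_left ?_ (sq_nonneg _)
      rw [mul_left_comm]
      exact mul_le_mul_of_nonneg_left (hxh ω k l) (sq_nonneg _)
  have hcol : ∑ a, ∑ l, ∑ k, ‖T a k l‖ ^ 2 * x l ^ 2 ≤ 1 := by
    rw [Finset.sum_comm, ← hx]
    refine Finset.sum_le_sum fun l _ => ?_
    simp_rw [← Finset.sum_mul]
    exact mul_le_of_le_one_left (sq_nonneg _) (sum_norm_sq_column_le_one hH hA l)
  have hrow : ∑ a, ∑ l, ∑ k, ‖T a k l‖ ^ 2 * x k ^ 2 ≤ 1 := by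
    have : ∀ a, ∑ l, ∑ k, ‖T a k l‖ ^ 2 * x k ^ 2 = ∑ k, ∑ l, ‖T a k l‖ ^ 2 * x k ^ 2 :=
      fun a => Finset.sum_comm
    simp_rw [this]
    rw [Finset.sum_comm, ← hx]
    refine Finset.sum_le_sum fun k _ => ?_
    simp_rw [← Finset.sum_mul]
    exact mul_le_of_le_one_left (sq_nonneg _) (sum_norm_sq_row_le_one hH hP hA k)
  have hsum := Finset.sum_le_sum fun a (_ : a ∈ Finset.univ) => hbound a
  have hsplit : ∑ a, ∑ l, ∑ k, ‖T a k l‖ ^ 2 * (x l ^ 2 + x k ^ 2) * I =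
      (∑ a, ∑ l, ∑ k, ‖T a k l‖ ^ 2 * x l ^ 2 + ∑ a, ∑ l, ∑ k, ‖T a k l‖ ^ 2 * x k ^ 2) * I := by
    simp only [← Finset.sum_add_distrib, Finset.sum_mul, mul_add]
  rw [hsplit] at hsum
  have := hsum.trans (mul_le_mul_of_nonneg_right (add_le_add hcol hrow) hI0)
  linarith

end DiagonalStates

/-! ### Approximate stationarity of the Gibbs state -/

section Gibbs

variable {d m : ℕ} {H : Matrix (Fin d) (Fin d) ℂ} {A : Fin m → Matrix (Fin d) (Fin d) ℂ}
  {σ β : ℝ} {γ : ℝ → ℝ}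

/-- The square roots of the Gibbs weights of the eigenstates of `H`. -/
noncomputable def sqrtGibbsWeight (hH : H.IsHermitian) (β : ℝ) (k : Fin d) : ℝ :=
  (√(∑ k, Real.exp (-β * hH.eigenvalues k)))⁻¹ * Real.exp (-β * hH.eigenvalues k / 2)

lemma sum_sqrtGibbsWeight_sq (hd : 0 < d) (hH : H.IsHermitian) (β : ℝ) :
    ∑ k, sqrtGibbsWeight hH β k ^ 2 = 1 := by
  have : Nonempty (Fin d) := ⟨⟨0, hd⟩⟩
  have hZ : 0 < ∑ k, Real.exp (-β * hH.eigenvalues k) :=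
    Finset.sum_pos (fun k _ => Real.exp_pos _) Finset.univ_nonempty
  simp_rw [sqrtGibbsWeight, mul_pow, inv_pow, Real.sq_sqrt hZ.le, ← Real.exp_nat_mul]
  rw [← Finset.mul_sum, inv_mul_eq_one₀ hZ.ne']
  refine Finset.sum_congr rfl fun k _ => ?_
  congr 1
  push_cast
  ring

lemma purifiedGibbs_eq_diagonalState (hH : H.IsHermitian) (β : ℝ) :
    purifiedGibbs hH β = diagonalState hH (sqrtGibbsWeight hH β) := by
  refine PiLp.ext fun p => ?_
  change _ = ((hH.eigenvectorUnitary : Matrix (Fin d) (Fin d) ℂ) *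
    Matrix.diagonal (fun k => (sqrtGibbsWeight hH β k : ℂ)) *
      (hH.eigenvectorUnitary : Matrix (Fin d) (Fin d) ℂ)ᴴ) p.1 p.2
  rw [Matrix.mul_apply]
  simp only [purifiedGibbs, Matrix.mul_diagonal, Matrix.conjTranspose_apply,
    Matrix.IsHermitian.eigenvectorUnitary_apply, Finset.mul_sum, sqrtGibbsWeight, RCLike.star_def]
  refine Finset.sum_congr rfl fun k _ => ?_
  push_cast
  ring

/-- `|e^{-y} - 1| ≤ max(1, e^{-y}) |y|`, and the squared maximum is at most the sum of squares.
Keeping both amplitudes avoids an exponential factor in the mismatch `y`. -/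
lemma sq_mul_exp_sub_le {b y : ℝ} : (b * Real.exp (-y) - b) ^ 2 ≤
    ((b * Real.exp (-y)) ^ 2 + b ^ 2) * y ^ 2 := by
  have h : (Real.exp (-y) - 1) ^ 2 ≤ (Real.exp (-y) ^ 2 + 1) * y ^ 2 := by
    have h1 := Real.add_one_le_exp (-y)
    have h2 := Real.add_one_le_exp y
    have h3 : Real.exp (-y) * Real.exp y = 1 := by rw [← Real.exp_add]; simp
    have h4 := Real.exp_pos (-y)
    rcases le_total 0 y with hy | hy
    · have h5 : Real.exp (-y) ≤ 1 := Real.exp_le_one_iff.2 (by linarith)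
      have : (Real.exp (-y) - 1) ^ 2 ≤ y ^ 2 := by
        rw [← neg_sq, neg_sub]
        exact pow_le_pow_left₀ (by linarith) (by linarith) 2
      nlinarith [sq_nonneg (Real.exp (-y) * y)]
    · have h5 : 1 ≤ Real.exp (-y) := Real.one_le_exp (by linarith)
      have : (Real.exp (-y) - 1) ^ 2 ≤ (Real.exp (-y) * -y) ^ 2 := by
        refine pow_le_pow_left₀ (by linarith) ?_ 2
        nlinarith
      nlinarith [sq_nonneg y]
  calc (b * Real.exp (-y) - b) ^ 2 = b ^ 2 * (Real.exp (-y) - 1) ^ 2 := by ring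
    _ ≤ b ^ 2 * ((Real.exp (-y) ^ 2 + 1) * y ^ 2) := by gcongr
    _ = _ := by ring

lemma neg_sq_le_re_inner_purifiedGibbs (hd : 0 < d) (hH : H.IsHermitian) (hσ : 0 < σ)
    (hγ : AEMeasurable γ) (hKMS : ∀ ω, γ ω = Real.exp (-β * ω) * γ (-ω))
    (h01 : ∀ ω, 0 ≤ γ ω ∧ γ ω ≤ 1) {P : Equiv.Perm (Fin m)} (hP : ∀ a, A (P a) = (A a)ᴴ)
    (hA : ‖Matrix.toEuclideanCLM (n := Fin d) (𝕜 := ℂ) (∑ a, (A a)ᴴ * A a)‖ ≤ 1) :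
    -(β / (4 * σ)) ^ 2 ≤ (inner ℂ (purifiedGibbs hH β) (Matrix.toEuclideanLin
        (discriminantProxy H A (gaussianFilter σ) γ) (purifiedGibbs hH β))).re := by
  have hs : 0 < 1 / (2 * σ) := by positivity
  have e : ∀ u, gaussianFilter (1 / (2 * σ)) u ^ 2 * (β / 2 * u) ^ 2 =
      (β / 2) ^ 2 * (gaussianFilter (1 / (2 * σ)) u ^ 2 * u ^ 2) := fun u => by ring
  rw [purifiedGibbs_eq_diagonalState]
  convert neg_integral_le_re_inner_diagonalState hH hσ hγ h01 hP hA
    (sum_sqrtGibbsWeight_sq hd hH β) (h := fun u => (β / 2 * u) ^ 2) ?_ (fun u => sq_nonneg _)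
    ?_ using 1
  · simp_rw [e]
    rw [integral_const_mul, integral_gaussianFilter_sq_mul_sq hs]
    field_simp
    ring
  · simp_rw [e]
    exact (integrable_gaussianFilter_sq_mul_sq hs).const_mul _
  · intro ω k l
    set u := ω - (hH.eigenvalues k - hH.eigenvalues l) with hu
    set x := sqrtGibbsWeight hH β
    -- Detailed balance for `γ` combines with the Gibbs ratio `xₗ / xₖ`; the two would cancel
    -- exactly at `ω = Eₖ - Eₗ`.
    have hx : √(γ ω) * x l = √(γ (-ω)) * x k * Real.exp (-(β / 2 * u)) := by
      have h1 : √(γ ω) = Real.exp (-β * ω / 2) * √(γ (-ω)) := by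
        rw [hKMS ω, Real.sqrt_mul (Real.exp_pos _).le, Real.exp_half]
      have h2 : x l = x k * Real.exp (β / 2 * (hH.eigenvalues k - hH.eigenvalues l)) := by
        simp only [x, sqrtGibbsWeight]
        rw [mul_assoc, ← Real.exp_add]
        congr 2
        ring
      have h3 : Real.exp (-(β / 2 * u)) = Real.exp (-β * ω / 2) *
          Real.exp (β / 2 * (hH.eigenvalues k - hH.eigenvalues l)) := by
        rw [← Real.exp_add, hu]
        congr 1
        ring
      rw [h1, h2, h3]
      ring
    have hle : ∀ (ω : ℝ) k, (√(γ ω) * x k) ^ 2 ≤ x k ^ 2 := fun ω k => by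
      rw [mul_pow, Real.sq_sqrt (h01 ω).1]
      exact mul_le_of_le_one_left (sq_nonneg _) (h01 ω).2
    have h := sq_mul_exp_sub_le (b := √(γ (-ω)) * x k) (y := β / 2 * u)
    rw [← hx] at h
    exact h.trans (mul_le_mul_of_nonneg_right (add_le_add (hle ω l) (hle (-ω) k)) (sq_nonneg _))

/-- Nonnegative amplitudes make the cross term harmless, so the constant function `1` serves as `h`.
This crude bound serves only to cap the gap. -/
lemma neg_one_le_re_inner_diagonalState (hH : H.IsHermitian) (hσ : 0 < σ)
    (hγ : AEMeasurable γ) (h01 : ∀ ω, 0 ≤ γ ω ∧ γ ω ≤ 1) {P : Equiv.Perm (Fin m)}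
    (hP : ∀ a, A (P a) = (A a)ᴴ)
    (hA : ‖Matrix.toEuclideanCLM (n := Fin d) (𝕜 := ℂ) (∑ a, (A a)ᴴ * A a)‖ ≤ 1)
    {x : Fin d → ℝ} (hx : ∑ k, x k ^ 2 = 1) (hx0 : ∀ k, 0 ≤ x k) :
    -1 ≤ (inner ℂ (diagonalState hH x) (Matrix.toEuclideanLin
        (discriminantProxy H A (gaussianFilter σ) γ) (diagonalState hH x))).re := by
  have hs : 0 < 1 / (2 * σ) := by positivity
  convert neg_integral_le_re_inner_diagonalState hH hσ hγ h01 hP hA hx (h := fun _ => 1) ?_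
    (fun u => zero_le_one) ?_ using 1
  · simp_rw [mul_one]
    rw [integral_gaussianFilter_sq hs]
  · simpa only [mul_one] using integrable_gaussianFilter_sq hs
  · intro ω k l
    have hle : ∀ (ω : ℝ) k, (√(γ ω) * x k) ^ 2 ≤ x k ^ 2 := fun ω k => by
      rw [mul_pow, Real.sq_sqrt (h01 ω).1]
      exact mul_le_of_le_one_left (sq_nonneg _) (h01 ω).2
    have h0 : 0 ≤ (√(γ ω) * x l) * (√(γ (-ω)) * x k) :=
      mul_nonneg (mul_nonneg (Real.sqrt_nonneg _) (hx0 l))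
        (mul_nonneg (Real.sqrt_nonneg _) (hx0 k))
    nlinarith [hle ω l, hle (-ω) k]

end Gibbs

end GibbsSampling

/-! ### Assembly of the main theorem -/

theorem theorem4 :
    ∃ C : ℝ, 0 < C ∧
      ∀ (d m : ℕ) (_ : 2 ≤ d)
        (H : Matrix (Fin d) (Fin d) ℂ) (hH : H.IsHermitian)
        (A : Fin m → Matrix (Fin d) (Fin d) ℂ)
        (_ : ∃ P : Equiv.Perm (Fin m), ∀ a, A (P a) = (A a)ᴴ)
        (_ : ‖Matrix.toEuclideanCLM (n := Fin d) (𝕜 := ℂ) (∑ a, (A a)ᴴ * A a)‖ ≤ 1)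
        (β σ : ℝ) (_ : 0 < β) (_ : 0 < σ)
        (γ : ℝ → ℝ) (_ : AEMeasurable γ MeasureTheory.volume)
        (_ : ∀ ω, γ ω = Real.exp (-β * ω) * γ (-ω))
        (_ : ∀ ω, 0 ≤ γ ω ∧ γ ω ≤ 1),
        ∃ hD : (GibbsSampling.discriminantProxy H A (GibbsSampling.gaussianFilter σ) γ).IsHermitian,
          0 < GibbsSampling.spectralGap hD →
            ∀ v : EuclideanSpace ℂ (Fin d × Fin d), ‖v‖ = 1 →
              Matrix.toEuclideanLin
                  (GibbsSampling.discriminantProxy H A (GibbsSampling.gaussianFilter σ) γ) v =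
                ((GibbsSampling.sortedEigenvalue hD 0 : ℝ) : ℂ) • v →
              ∃ z : ℂ, ‖z‖ = 1 ∧
                ‖z • v - GibbsSampling.purifiedGibbs hH β‖ ≤
                  C * (β / σ * √(Real.log (2 + σ / β))) / GibbsSampling.spectralGap hD := by
  refine ⟨1, one_pos, ?_⟩
  rintro d m hd H hH A ⟨P, hP⟩ hA β σ hβ hσ γ hγ hKMS h01
  have hD := GibbsSampling.isHermitian_discriminantProxy hH hσ hγ h01 hP
  refine ⟨hD, fun hgap v hv hDv => ?_⟩
  have hn : 1 < Fintype.card (Fin d × Fin d) := by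
    rw [Fintype.card_prod, Fintype.card_fin]
    nlinarith
  let e : Fin 2 → Fin d := Fin.castLE hd
  have he : Function.Injective e := Fin.castLE_injective hd
  -- The two orthonormal test states are `ψ ⊗ ψ*` for two distinct eigenvectors, available since `d
  -- ≥ 2`.
  let x : Fin 2 → Fin d → ℝ := fun i => Pi.single (e i) 1
  have hxx : ∀ i j, ∑ k, x i k * x j k = if i = j then 1 else 0 := by
    intro i j
    simp [x, Pi.single_apply, he.eq_iff, eq_comm]
  have hx : ∀ i, ∑ k, x i k ^ 2 = 1 := fun i => by
    simpa only [sq, if_true] using hxx i i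
  have hx0 : ∀ i k, 0 ≤ x i k := fun i k => by
    simp only [x, Pi.single_apply]
    positivity
  have horth : Orthonormal ℂ fun i => GibbsSampling.diagonalState hH (x i) := by
    rw [orthonormal_iff_ite]
    intro i j
    rw [GibbsSampling.inner_diagonalState, hxx]
    split_ifs <;> simp
  have hnorm : ‖GibbsSampling.purifiedGibbs hH β‖ = 1 := by
    have h := GibbsSampling.inner_diagonalState hH (GibbsSampling.sqrtGibbsWeight hH β)
      (GibbsSampling.sqrtGibbsWeight hH β)
    simp_rw [← sq] at h
    rw [GibbsSampling.sum_sqrtGibbsWeight_sq (by omega) hH β,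
      ← GibbsSampling.purifiedGibbs_eq_diagonalState] at h
    have h' : ‖GibbsSampling.purifiedGibbs hH β‖ ^ 2 = 1 := by
      rw [norm_sq_eq_re_inner (𝕜 := ℂ), h]
      simp
    exact (pow_eq_one_iff_of_nonneg (norm_nonneg _) two_ne_zero).1 h'
  obtain ⟨z, hz, hzv⟩ := GibbsSampling.exists_phase_norm_sub_le_of_form_bounds hD hn hgap hv hDv
    (GibbsSampling.re_inner_discriminantProxy_nonpos hH hσ hγ h01 hP) horth
    (fun i => GibbsSampling.neg_one_le_re_inner_diagonalState hH hσ hγ h01 hP hA (hx i) (hx0 i))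
    hnorm (by positivity : 0 ≤ β / (4 * σ))
    (GibbsSampling.neg_sq_le_re_inner_purifiedGibbs (by omega) hH hσ hγ hKMS h01 hP hA)
  refine ⟨z, hz, hzv.trans ?_⟩
  -- Since `2ε = (β/σ)/2`, the constant `1` suffices once the root is at least `1/2`, which follows
  -- from `log 2 ≥ 1/4`.
  have hlog : 1 / 2 ≤ √(Real.log (2 + σ / β)) := by
    refine Real.le_sqrt_of_sq_le ?_
    have h1 : Real.log 2 ≤ Real.log (2 + σ / β) :=
      Real.log_le_log two_pos (by linarith [div_pos hσ hβ])
    linarith [Real.log_two_gt_d9]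
  have h2 : 2 * (β / (4 * σ)) = β / σ * (1 / 2) := by
    field_simp
    norm_num
  rw [h2, one_mul]
  gcongr
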